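/- Let $d\ge 2$ be an integer and $f_c(z)=z^d+c$. Let $\mathcal O$ be an integral domain and $c$ an indeterminate. For $m\ge 1$ let $\Phi_m^*(z)=\prod_{k\mid m}(f_c^{\circ k}(z)-z)^{\mu(m/k)}\in\mathcal O[c][z]$ be the $m$-th dynatomic polynomial of $f_c$, and let $\delta_m(x)\in\mathcal O[c][x]$ be its $m$-th multiplier polynomial, i.e. the monic polynomial with $\delta_m(x)^m=\prod_{\Phi_m^*(\alpha)=0}\bigl(x-(f_c^{\circ m})'(\alpha)\bigr)$, the product being over the roots $\alpha$ of $\Phi_m^*$ in an algebraic closure of $\operatorname{Frac}(\mathcal O[c])$, counted with multiplicity. An $m$-periodic point ($m\ge1$) of a polynomial $f$ is a point $z_0$ with $f^{\circ m}(z_0)=z_0$; its multiplier is $(f^{\circ m})'(z_0)$. 1. For every $m\ge 1$ and every monic $\Phi(x)\in\mathcal O[x]$ there is a polynomial $\Psi(t)\in\mathcal O[t]$ such that $\operatorname{Res}_x(\Phi(x),\delta_m(x))=\Psi(d^dc^{d-1})$; and if $d\ne 0$ in $\mathcal O$, then $\Psi$ or $-\Psi$ is monic. 2. Let $\gamma\in\mathcal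 O$. If $f_\gamma$ has an $m$-periodic point $z_0\in\overline{\operatorname{Frac}(\mathcal O)}$, for some $m\ge1$, whose multiplier $(f_\gamma^{\circ m})'(z_0)$ is integral over $\mathbb Z$, then $d^d\gamma^{d-1}$ is integral over $\mathbb Z$. 3. Let $\gamma\in\mathbb C$. If $f_\gamma$ has a parabolic $m$-periodic point $z_0\in\mathbb C$ for some $m\ge 1$ (that is, its multiplier is a root of unity), then $d^d\gamma^{d-1}$ is an algebraic integer. If moreover $\gamma$ is rational, then $d^d\gamma^{d-1}$ is an integer. -/

import Mathlib

open Polynomial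

/-- The unicritical polynomial `f_c(z) = z ^ d + c` over a commutative ring. -/
noncomputable def unicritical {R : Type*} [CommRing R] (d : ℕ) (c : R) : R[X] :=
  X ^ d + C c

/-- The `n`-fold composition `f ∘ f ∘ ⋯ ∘ f` of a polynomial with itself
(for `n = 0` it is `z`). -/
noncomputable def iterPoly {R : Type*} [CommRing R] (f : R[X]) (n : ℕ) : R[X] :=
  f.comp^[n] X

/-- `α` is an `n`-periodic point of `f`, i.e. `n ≥ 1` and the `n`-fold iterate of `f` fixes `α`,
where `α` lies in an algebra over the coefficient ring of `f`. -/
def IsPeriodicPoint {R A : Type*} [CommRing R] [CommRing A] [Algebra R A]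
    (f : R[X]) (n : ℕ) (α : A) : Prop :=
  0 < n ∧ Function.IsPeriodicPt (fun w : A => aeval w f) n α

/-- The multiplier `ω_n(α)`: the derivative of the `n`-fold iterate of `f`, evaluated at `α`. -/
noncomputable def multiplier {R A : Type*} [CommRing R] [CommRing A] [Algebra R A]
    (f : R[X]) (n : ℕ) (α : A) : A :=
  aeval α (derivative (iterPoly f n))

/-- The `n`-th dynatomic polynomial `∏_{k ∣ n} (f^{∘k}(z) - z) ^ μ(n/k)` of a monic polynomial `f`
of degree at least two.  The factors with `μ(n/k) = 1` form the numerator, those with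
`μ(n/k) = -1` form the denominator, which is monic, so that the division is
division of polynomials over `R`. -/
noncomputable def dynatomic {R : Type*} [CommRing R] (f : R[X]) (n : ℕ) : R[X] :=
  (∏ k ∈ n.divisors with ArithmeticFunction.moebius (n / k) = 1, (iterPoly f k - X)) /ₘ
    (∏ k ∈ n.divisors with ArithmeticFunction.moebius (n / k) = -1, (iterPoly f k - X))

/-- The product `∏_{Φ_n^*(α) = 0} (x - ω_n(α))` over the roots `α` of the `n`-th dynatomic
polynomial of `f` in an algebraic closure of the fraction field of `R`, counted with
multiplicity. -/
noncomputable def multiplierProd {R : Type*} [CommRing R] [IsDomain R] (f : R[X]) (n : ℕ) :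
    (AlgebraicClosure (FractionRing R))[X] :=
  (((dynatomic f n).aroots (AlgebraicClosure (FractionRing R))).map
    fun α => X - C (multiplier f n α)).prod

/-- `δ` is the `n`-th multiplier polynomial of `f`: it is monic and
`δ(x) ^ n = ∏_{Φ_n^*(α) = 0} (x - ω_n(α))`.  For `n ≥ 1` there is at most one such `δ`. -/
def IsMultiplierPoly {R : Type*} [CommRing R] [IsDomain R] (f : R[X]) (n : ℕ) (δ : R[X]) : Prop :=
  δ.Monic ∧
    δ.map (algebraMap R (AlgebraicClosure (FractionRing R))) ^ n = multiplierProd f n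

open Classical in
/-- The `n`-th multiplier polynomial `δ_n(x)` of a monic polynomial `f` of degree at least two over
an integral domain (the value `0` if no polynomial has the defining property). -/
noncomputable def multiplierPoly {R : Type*} [CommRing R] [IsDomain R] (f : R[X]) (n : ℕ) : R[X] :=
  if h : ∃ δ : R[X], IsMultiplierPoly f n δ then h.choose else 0

/-- `α` is a parabolic `n`-periodic point of the complex polynomial `f`: it is an `n`-periodic
point and its multiplier is a root of unity. -/
def IsParabolicPeriodicPoint (f : ℂ[X]) (n : ℕ) (α : ℂ) : Prop :=
  IsPeriodicPoint f n α ∧ ∃ k : ℕ, 0 < k ∧ multiplier f n α ^ k = 1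

/-! Put t = d^d c^(d-1) and choose b with b^(d-1) = d. Along a cycle z_i the rescaled points w_i = b
z_i satisfy w_i^d = d w_{i+1} - d b c, the multiplier is ∏ w_i^(d-1), and (d b c)^(d-1) = t. If some
valuation gave |d b c| > 1, then |w_i|^d = |d b c| for every i, so all |w_i| > 1 and the multiplier
would not be integral. Hence an integral multiplier forces t to be integral
(`isIntegral_of_isIntegral_multiplier`). This is the second claim, and it contains the third, roots
of unity being integral.

For the first claim, let t be transcendental. No multiplier is then 1, so f^n(z) - z has simple
roots and Φ_m^* is the product over the points of exact period m. Their multipliers are integral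
over ℤ[t] (`isIntegral_multiplier`), constant on cycles, and permuted by Galois: an automorphism σ
fixing t sends c to c/u with u^(d-1) = 1, and z ↦ u σ(z) commutes with f_c. So δ_m comes from a
monic D in ℤ[t][x] (`exists_universal`), which specialises to every O.

For monicity, expand at t = ∞. With ξ^d d b c = 1, the points y_i = ξ w_i of a cycle are integral
over ℤ[ξ] and y_i^d ≡ -1 mod ξ. Hence the constant coefficient of D in x has leading coefficient ±1
in t and larger t-degree than the others (`universalMultiplierPoly_coeff`). Finally Ψ = Res_x(Φ, D)
is the product of the D(t, r) over the roots r of Φ, each monic up to sign. -/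

/-! ### Integrality through valuation rings, and cyclic systems of equations. -/

/-- An element of a field lying in every valuation subring that contains the image of `R` is
integral over `R`. -/
theorem isIntegral_of_forall_valuationSubring {R K : Type*} [CommRing R] [Field K] [Algebra R K]
    {x : K} (h : ∀ V : ValuationSubring K, (∀ r : R, algebraMap R K r ∈ V) → x ∈ V) :
    IsIntegral R x := by
  by_contra hx
  have : IsIntegrallyClosedIn (integralClosure R K).toSubring K :=
    inferInstanceAs (IsIntegrallyClosedIn (integralClosure R K) K)
  obtain ⟨V, hV, hxV⟩ := Subring.exists_le_valuationSubring_of_isIntegrallyClosedIn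
    (R := (integralClosure R K).toSubring) (x := x) hx
  exact hxV (h V fun r => hV ((integralClosure R K).algebraMap_mem r))

/-- A valuation subring containing the image of `R` contains every element integral over `R`. -/
theorem IsIntegral.mem_valuationSubring {R K : Type*} [CommRing R] [Field K] [Algebra R K]
    {x : K} (hx : IsIntegral R x) (V : ValuationSubring K) (hV : ∀ r : R, algebraMap R K r ∈ V) :
    x ∈ V := by
  obtain ⟨p, hp, h0⟩ := hx
  let φ : R →+* V := (algebraMap R K).codRestrict V.toSubring hV
  have hint : IsIntegral V x := by
    refine ⟨p.map φ, hp.map φ, ?_⟩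
    rw [eval₂_map]
    exact h0
  obtain ⟨y, rfl⟩ := IsIntegrallyClosed.isIntegral_iff.1 hint
  exact y.2

theorem exists_forall_le_of_periodic {α : Type*} [LinearOrder α] {v : ℕ → α} {m : ℕ} (hm : 0 < m)
    (hv : Function.Periodic v m) : ∃ i, ∀ j, v j ≤ v i := by
  obtain ⟨i, -, hi⟩ := (Finset.range m).exists_max_image v ⟨0, by simpa using hm⟩
  refine ⟨i, fun j => ?_⟩
  rw [← hv.map_mod_nat j]
  exact hi _ (by simpa using Nat.mod_lt j hm)

/-- Solutions of a cyclic system `w_i ^ d = p w_{i+1} + q` with integral coefficients are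
integral. -/
theorem isIntegral_of_periodic_of_pow_eq {R K : Type*} [CommRing R] [Field K] [Algebra R K]
    {d m : ℕ} (hd : 2 ≤ d) (hm : 0 < m) {p q : K} (hp : IsIntegral R p) (hq : IsIntegral R q)
    {w : ℕ → K} (hper : Function.Periodic w m) (hw : ∀ i, w i ^ d = p * w (i + 1) + q) (i : ℕ) :
    IsIntegral R (w i) := by
  refine isIntegral_of_forall_valuationSubring fun V hV => ?_
  have hp' := (V.valuation_le_one_iff _).2 (hp.mem_valuationSubring V hV)
  have hq' := (V.valuation_le_one_iff _).2 (hq.mem_valuationSubring V hV)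
  obtain ⟨k, hk⟩ := exists_forall_le_of_periodic hm (hper.comp V.valuation)
  rw [← V.valuation_le_one_iff]
  refine (hk i).trans (not_lt.1 fun h1 => ?_)
  simp only [Function.comp_apply] at hk h1
  -- At an index of largest valuation, assumed > 1, the equation bounds |w_k|^d by |w_k|, which is
  -- absurd for d ≥ 2.
  have h2 : V.valuation (w k) ^ d ≤ V.valuation (w k) := by
    rw [← map_pow, hw]
    refine V.valuation.map_add_le ?_ (hq'.trans h1.le)
    rw [map_mul]
    exact (mul_le_of_le_one_left' hp').trans (hk _)
  exact absurd h2 (not_le.2 (lt_self_pow₀ h1 hd))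

/-- In a cyclic system `w_i ^ d = p w_{i+1} + q` with `p` and the product of the `w_i` integral,
the constant `q` is integral. -/
theorem isIntegral_const_of_periodic_of_pow_eq {R K : Type*} [CommRing R] [Field K] [Algebra R K]
    {d m : ℕ} (hd : 2 ≤ d) (hm : 0 < m) {p q : K} (hp : IsIntegral R p)
    {w : ℕ → K} (hper : Function.Periodic w m) (hw : ∀ i, w i ^ d = p * w (i + 1) + q)
    (hprod : IsIntegral R (∏ i ∈ Finset.range m, w i ^ (d - 1))) : IsIntegral R q := by
  refine isIntegral_of_forall_valuationSubring fun V hV => ?_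
  have hp' := (V.valuation_le_one_iff _).2 (hp.mem_valuationSubring V hV)
  have hprod' := (V.valuation_le_one_iff _).2 (hprod.mem_valuationSubring V hV)
  obtain ⟨k, hk⟩ := exists_forall_le_of_periodic hm (hper.comp V.valuation)
  simp only [Function.comp_apply] at hk
  rw [← V.valuation_le_one_iff]
  by_contra! hq
  have hpw (j : ℕ) : V.valuation (p * w (j + 1)) ≤ V.valuation (w k) := by
    rw [map_mul]
    exact (mul_le_of_le_one_left' hp').trans (hk _)
  -- Otherwise the largest |w_k| is at least |q| > 1, and again |w_k|^d ≤ |w_k|.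
  have hlt : V.valuation (w k) < V.valuation q := by
    by_contra! h
    have h2 : V.valuation (w k) ^ d ≤ V.valuation (w k) := by
      rw [← map_pow, hw]
      exact V.valuation.map_add_le (hpw k) h
    exact absurd h2 (not_le.2 (lt_self_pow₀ (hq.trans_le h) hd))
  -- As q strictly dominates p w_{j+1}, the ultrametric inequality is an equality: |w_j|^d = |q|.
  have hone (j : ℕ) : 1 < V.valuation (w j) := by
    have h3 : V.valuation (w j) ^ d = V.valuation q := by
      rw [← map_pow, hw, add_comm]
      exact V.valuation.map_add_eq_of_lt_left ((hpw j).trans_lt hlt)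
    exact (one_lt_pow_iff_of_nonneg zero_le (by lia)).1 (h3 ▸ hq)
  refine absurd hprod' (not_le.2 ?_)
  rw [map_prod]
  have : (∏ i ∈ Finset.range m, (1 : V.ValueGroup)) <
      ∏ i ∈ Finset.range m, V.valuation (w i ^ (d - 1)) := by
    refine Finset.prod_lt_prod_of_nonempty (fun _ _ => zero_lt_one) (fun i _ => ?_)
      ⟨0, by simpa using hm⟩
    rw [map_pow]
    exact one_lt_pow₀ (hone i) (by lia)
  simpa using this

/-! ### Iterates and multipliers. -/

section Iterates

variable {R S A : Type*} [CommRing R] [CommRing S] [CommRing A]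

theorem unicritical_map (φ : R →+* S) (d : ℕ) (c : R) :
    (unicritical d c).map φ = unicritical d (φ c) := by
  simp [unicritical]

theorem aeval_unicritical [Algebra R A] (d : ℕ) (c : R) (z : A) :
    aeval z (unicritical d c) = z ^ d + algebraMap R A c := by
  simp [unicritical]

theorem eval_unicritical (d : ℕ) (c z : R) : (unicritical d c).eval z = z ^ d + c := by
  simp [unicritical]

theorem unicritical_monic {d : ℕ} (hd : d ≠ 0) (c : R) : (unicritical d c).Monic :=
  monic_X_pow_add_C c hd

theorem natDegree_unicritical [Nontrivial R] {d : ℕ} (c : R) :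
    (unicritical d c).natDegree = d :=
  natDegree_X_pow_add_C

theorem iterPoly_zero (f : R[X]) : iterPoly f 0 = X := rfl

theorem iterPoly_succ (f : R[X]) (n : ℕ) : iterPoly f (n + 1) = f.comp (iterPoly f n) :=
  Function.iterate_succ_apply' _ _ _

theorem iterPoly_map (φ : R →+* S) (f : R[X]) (n : ℕ) :
    (iterPoly f n).map φ = iterPoly (f.map φ) n := by
  induction n with
  | zero => simp [iterPoly_zero]
  | succ n ih => rw [iterPoly_succ, iterPoly_succ, Polynomial.map_comp, ih]

theorem aeval_iterPoly [Algebra R A] (f : R[X]) (n : ℕ) (z : A) :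
    aeval z (iterPoly f n) = (fun w : A => aeval w f)^[n] z := by
  induction n with
  | zero => simp [iterPoly_zero]
  | succ n ih => rw [iterPoly_succ, aeval_comp, ih, Function.iterate_succ_apply']

theorem eval_iterPoly (f : R[X]) (n : ℕ) (z : R) :
    (iterPoly f n).eval z = (fun w => f.eval w)^[n] z := by
  simpa using aeval_iterPoly f n z

theorem iterPoly_monic_and_natDegree {f : R[X]} [Nontrivial R] (hf : f.Monic)
    (hf0 : f.natDegree ≠ 0) (n : ℕ) :
    (iterPoly f n).Monic ∧ (iterPoly f n).natDegree = f.natDegree ^ n := by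
  induction n with
  | zero => simp [iterPoly_zero, monic_X]
  | succ n ih =>
    have h : (iterPoly f n).natDegree ≠ 0 := by rw [ih.2]; positivity
    rw [iterPoly_succ]
    refine ⟨hf.comp ih.1 h, ?_⟩
    rw [natDegree_comp_eq_of_mul_ne_zero, ih.2, pow_succ, mul_comm]
    simp [hf.leadingCoeff, ih.1.leadingCoeff]

theorem iterPoly_sub_X_monic {f : R[X]} (hf : f.Monic) (hf2 : 2 ≤ f.natDegree) {n : ℕ}
    (hn : n ≠ 0) : (iterPoly f n - X).Monic := by
  nontriviality R
  obtain ⟨h1, h2⟩ := iterPoly_monic_and_natDegree hf (by lia) n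
  refine h1.sub_of_left (degree_lt_degree ?_)
  rw [h2, natDegree_X]
  exact Nat.one_lt_pow hn hf2

theorem multiplier_eq_prod [Algebra R A] (f : R[X]) (n : ℕ) (z : A) :
    multiplier f n z =
      ∏ i ∈ Finset.range n, aeval ((fun w : A => aeval w f)^[i] z) (derivative f) := by
  unfold multiplier
  induction n with
  | zero => simp [iterPoly_zero]
  | succ n ih =>
    rw [iterPoly_succ, derivative_comp, map_mul, ih, Finset.prod_range_succ, aeval_comp,
      aeval_iterPoly]

theorem multiplier_unicritical [Algebra R A] (d : ℕ) (c : R) (n : ℕ) (z : A) :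
    multiplier (unicritical d c) n z =
      ∏ i ∈ Finset.range n,
        (d : A) * ((fun w : A => w ^ d + algebraMap R A c)^[i] z) ^ (d - 1) := by
  simp only [multiplier_eq_prod, aeval_unicritical]
  simp [unicritical, derivative_X_pow]

theorem multiplier_map [Algebra R A] (f : R[X]) (n : ℕ) (z : A) :
    multiplier (f.map (algebraMap R A)) n z = multiplier f n z := by
  unfold multiplier
  rw [← iterPoly_map, derivative_map, aeval_map_algebraMap]

end Iterates

/-! ### The rescaled orbit, and parameters with an integral multiplier. -/

section Unicritical

variable {K : Type*} [Field K]

/-- The iterates of `z ↦ z ^ d + c`, rescaled by `b` with `b ^ (d - 1) = d`, solve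
`w_i ^ d = d w_{i+1} - d b c`. -/
theorem rescaled_iterate_pow {d : ℕ} (hd : 2 ≤ d) {b : K} (hb : b ^ (d - 1) = d) (c z : K)
    (i : ℕ) :
    (b * (fun w : K => w ^ d + c)^[i] z) ^ d =
      d * (b * (fun w : K => w ^ d + c)^[i + 1] z) + -(d * b * c) := by
  have h : b ^ d = d * b := by rw [← hb, ← pow_succ, Nat.sub_add_cancel (by lia)]
  rw [mul_pow, h, Function.iterate_succ_apply']
  ring

/-- Converts integrality of the constant term d b c of the cyclic system into integrality of t, and
back. -/
theorem rescaled_const_pow {d : ℕ} (hd : 2 ≤ d) {b : K} (hb : b ^ (d - 1) = d) (c : K) :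
    (d * b * c) ^ (d - 1) = d ^ d * c ^ (d - 1) := by
  obtain ⟨e, rfl⟩ := Nat.exists_eq_add_of_le hd
  have : 2 + e - 1 = e + 1 := by lia
  rw [this] at hb ⊢
  rw [mul_pow, mul_pow, hb]
  ring

theorem multiplier_eq_prod_rescaled {d : ℕ} {b : K} (hb : b ^ (d - 1) = d) (c z : K) (m : ℕ) :
    multiplier (unicritical d c) m z =
      ∏ i ∈ Finset.range m, (b * (fun w : K => w ^ d + c)^[i] z) ^ (d - 1) := by
  rw [multiplier_unicritical]
  simp [mul_pow, hb]

theorem periodic_rescaled {d m : ℕ} {c z : K}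
    (hz : Function.IsPeriodicPt (fun w : K => w ^ d + c) m z) (b : K) :
    Function.Periodic (fun i => b * (fun w : K => w ^ d + c)^[i] z) m := by
  intro i
  simp only
  rw [Function.iterate_add_apply, hz.eq]

variable [IsAlgClosed K]

theorem exists_pow_pred_eq {d : ℕ} (hd : 2 ≤ d) (x : K) : ∃ b : K, b ^ (d - 1) = x :=
  IsAlgClosed.exists_pow_nat_eq _ (by lia)

/-- If `z ↦ z ^ d + c` has a periodic point whose multiplier is integral over `R`, then
`d ^ d * c ^ (d - 1)` is integral over `R`. -/
theorem isIntegral_of_isIntegral_multiplier {R : Type*} [CommRing R] [Algebra R K]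
    {d m : ℕ} (hd : 2 ≤ d) (hm : 0 < m) {c z : K}
    (hz : Function.IsPeriodicPt (fun w : K => w ^ d + c) m z)
    (hω : IsIntegral R (multiplier (unicritical d c) m z)) :
    IsIntegral R ((d : K) ^ d * c ^ (d - 1)) := by
  obtain ⟨b, hb⟩ := exists_pow_pred_eq hd (d : K)
  rw [multiplier_eq_prod_rescaled hb] at hω
  rw [← rescaled_const_pow hd hb]
  have hdint : IsIntegral R (d : K) := by
    simpa using isIntegral_algebraMap (R := R) (A := K) (x := (d : R))
  have := isIntegral_const_of_periodic_of_pow_eq hd hm hdint (periodic_rescaled hz b)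
    (fun i => rescaled_iterate_pow hd hb c z i) hω
  simpa using this.neg.pow (d - 1)

end Unicritical

theorem algebraMap_algebraicClosure_fractionRing_injective (O : Type*) [CommRing O] [IsDomain O] :
    Function.Injective (algebraMap O (AlgebraicClosure (FractionRing O))) := by
  rw [IsScalarTower.algebraMap_eq O (FractionRing O) (AlgebraicClosure (FractionRing O))]
  exact (algebraMap (FractionRing O) _).injective.comp (IsFractionRing.injective O _)

/-- Parameters with a periodic point of integral multiplier. -/
theorem isIntegral_parameter_of_isIntegral_multiplier {d : ℕ} (hd : 2 ≤ d) {O : Type*}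
    [CommRing O] [IsDomain O] (γ : O) (m : ℕ) (z₀ : AlgebraicClosure (FractionRing O))
    (hz : IsPeriodicPoint (unicritical d γ) m z₀)
    (hω : IsIntegral ℤ (multiplier (unicritical d γ) m z₀)) :
    IsIntegral ℤ ((d : O) ^ d * γ ^ (d - 1)) := by
  have hinj : Function.Injective (algebraMap O (AlgebraicClosure (FractionRing O))) :=
    algebraMap_algebraicClosure_fractionRing_injective O
  rw [← multiplier_map, unicritical_map] at hω
  obtain ⟨hm, hz⟩ := hz
  simp_rw [aeval_unicritical] at hz
  have := isIntegral_of_isIntegral_multiplier hd hm hz hω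
  rw [← isIntegral_algebraMap_iff (R := ℤ) hinj]
  simpa using this

/-- Parabolic parameters. -/
theorem isIntegral_parameter_of_isParabolic {d : ℕ} (hd : 2 ≤ d) (γ : ℂ) (m : ℕ) (z₀ : ℂ)
    (h : IsParabolicPeriodicPoint (unicritical d γ) m z₀) :
    IsIntegral ℤ ((d : ℂ) ^ d * γ ^ (d - 1)) ∧
      ∀ q : ℚ, γ = (q : ℂ) → ∃ k : ℤ, (d : ℂ) ^ d * γ ^ (d - 1) = (k : ℂ) := by
  obtain ⟨⟨hm, hz⟩, k, hk, hω⟩ := h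
  simp_rw [aeval_unicritical] at hz
  have key : IsIntegral ℤ ((d : ℂ) ^ d * γ ^ (d - 1)) :=
    isIntegral_of_isIntegral_multiplier hd hm hz
      (IsIntegral.of_pow hk (by rw [hω]; exact isIntegral_one))
  refine ⟨key, ?_⟩
  rintro q rfl
  have hq : IsIntegral ℤ ((d : ℚ) ^ d * q ^ (d - 1)) := by
    rw [← isIntegral_algHom_iff (algebraMap ℚ ℂ).toIntAlgHom (algebraMap ℚ ℂ).injective]
    simpa using key
  obtain ⟨n, hn⟩ := IsIntegrallyClosed.isIntegral_iff.1 hq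
  refine ⟨n, ?_⟩
  have := congrArg (algebraMap ℚ ℂ) hn
  simpa using this.symm

/-! ### Factorisation of the dynatomic polynomial for non-integral t. -/

/-- The denominator is monic, and division by a monic polynomial commutes with ring homomorphisms.
-/
theorem dynatomic_map {R S : Type*} [CommRing R] [CommRing S] (φ : R →+* S) {f : R[X]}
    (hf : f.Monic) (hf2 : 2 ≤ f.natDegree) {n : ℕ} :
    (dynatomic f n).map φ = dynatomic (f.map φ) n := by
  unfold dynatomic
  rw [map_divByMonic, Polynomial.map_prod, Polynomial.map_prod]
  · simp only [Polynomial.map_sub, iterPoly_map, map_X]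
  · refine monic_prod_of_monic _ _ fun k hk => iterPoly_sub_X_monic hf hf2 ?_
    exact (Nat.pos_of_mem_divisors (Finset.mem_filter.1 hk).1).ne'

section Field

variable {K : Type*} [Field K]

theorem isRoot_iterPoly_sub_X {d : ℕ} {c : K} {n : ℕ} {α : K} :
    (iterPoly (unicritical d c) n - X).IsRoot α ↔
      Function.IsPeriodicPt (fun w : K => w ^ d + c) n α := by
  rw [IsRoot.def, eval_sub, eval_iterPoly, eval_X, sub_eq_zero]
  simp_rw [eval_unicritical]
  rfl

theorem iterPoly_unicritical_sub_X_monic {d : ℕ} (hd : 2 ≤ d) (c : K) {n : ℕ} (hn : n ≠ 0) :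
    (iterPoly (unicritical d c) n - X).Monic :=
  iterPoly_sub_X_monic (unicritical_monic (by lia) c) (by rwa [natDegree_unicritical]) hn

open Classical in
/-- The points of exact period `n` (for `n ≥ 1`) of `z ↦ z ^ d + c`. -/
noncomputable def exactPeriodPoints (d : ℕ) (c : K) (n : ℕ) : Finset K :=
  {α ∈ (iterPoly (unicritical d c) n - X).roots.toFinset |
    Function.minimalPeriod (fun w : K => w ^ d + c) α = n}

theorem mem_exactPeriodPoints {d : ℕ} (hd : 2 ≤ d) {c : K} {n : ℕ} (hn : n ≠ 0) {α : K} :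
    α ∈ exactPeriodPoints d c n ↔ Function.minimalPeriod (fun w : K => w ^ d + c) α = n := by
  simp only [exactPeriodPoints, Finset.mem_filter, Multiset.mem_toFinset,
    mem_roots (iterPoly_unicritical_sub_X_monic hd c hn).ne_zero, isRoot_iterPoly_sub_X,
    and_iff_right_iff_imp]
  rintro rfl
  exact Function.isPeriodicPt_minimalPeriod _ _

variable [IsAlgClosed K]

/-- A multiple root would be a periodic point of multiplier 1, and the integrality of 1 would make t
integral. -/
theorem nodup_roots_iterPoly_sub_X {d : ℕ} (hd : 2 ≤ d) {c : K}
    (hc : ¬ IsIntegral ℤ ((d : K) ^ d * c ^ (d - 1))) {n : ℕ} (hn : n ≠ 0) :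
    (iterPoly (unicritical d c) n - X).roots.Nodup := by
  classical
  rw [Multiset.nodup_iff_count_le_one]
  intro α
  rw [count_roots]
  by_contra! h
  have h0 := (iterPoly_unicritical_sub_X_monic hd c hn).ne_zero
  obtain ⟨h1, h2⟩ := (one_lt_rootMultiplicity_iff_isRoot h0).1 h
  refine hc (isIntegral_of_isIntegral_multiplier hd (Nat.pos_of_ne_zero hn)
    (isRoot_iterPoly_sub_X.1 h1) ?_)
  have : multiplier (unicritical d c) n α = 1 := by
    simpa [multiplier, sub_eq_zero, IsRoot.def] using h2
  rw [this]
  exact isIntegral_one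

/-- The roots are simple, so it suffices to sort them by exact period, a divisor of n. -/
theorem iterPoly_sub_X_eq_prod {d : ℕ} (hd : 2 ≤ d) {c : K}
    (hc : ¬ IsIntegral ℤ ((d : K) ^ d * c ^ (d - 1))) {n : ℕ} (hn : n ≠ 0) :
    iterPoly (unicritical d c) n - X =
      ∏ k ∈ n.divisors, ∏ α ∈ exactPeriodPoints d c k, (X - C α) := by
  classical
  have hmon := iterPoly_unicritical_sub_X_monic hd c hn
  rw [← Finset.prod_biUnion]
  · rw [(IsAlgClosed.splits (iterPoly (unicritical d c) n - X)).eq_prod_roots_of_monic hmon]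
    have hU : (n.divisors.biUnion fun k => exactPeriodPoints d c k) =
        (iterPoly (unicritical d c) n - X).roots.toFinset := by
      ext α
      rw [Finset.mem_biUnion, Multiset.mem_toFinset, mem_roots hmon.ne_zero, isRoot_iterPoly_sub_X,
        Function.isPeriodicPt_iff_minimalPeriod_dvd]
      constructor
      · rintro ⟨k, hk, hα⟩
        rw [mem_exactPeriodPoints hd (Nat.pos_of_mem_divisors hk).ne'] at hα
        exact hα ▸ Nat.dvd_of_mem_divisors hk
      · intro h
        exact ⟨_, Nat.mem_divisors.2 ⟨h, hn⟩,
          (mem_exactPeriodPoints hd (ne_zero_of_dvd_ne_zero hn h)).2 rfl⟩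
    rw [hU, Finset.prod, Multiset.toFinset_val, (nodup_roots_iterPoly_sub_X hd hc hn).dedup]
  · intro i hi j hj hij
    refine Finset.disjoint_left.2 fun α h1 h2 => hij ?_
    rw [mem_exactPeriodPoints hd (Nat.pos_of_mem_divisors hi).ne'] at h1
    rw [mem_exactPeriodPoints hd (Nat.pos_of_mem_divisors hj).ne'] at h2
    exact h1.symm.trans h2

/-- If `d ^ d * c ^ (d - 1)` is not integral over `ℤ`, the roots of the dynatomic polynomial are
the points of exact period `n`, all simple. -/
theorem dynatomic_eq_prod {d : ℕ} (hd : 2 ≤ d) {c : K}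
    (hc : ¬ IsIntegral ℤ ((d : K) ^ d * c ^ (d - 1))) {n : ℕ} (hn : n ≠ 0) :
    dynatomic (unicritical d c) n = ∏ α ∈ exactPeriodPoints d c n, (X - C α) := by
  -- Möbius inversion has negative exponents, so it is carried out in the fraction field of K[X];
  -- the resulting identity is then cleared of denominators.
  let ι := algebraMap K[X] (FractionRing K[X])
  have hι : Function.Injective ι := IsFractionRing.injective _ _
  let P : ℕ → K[X] := fun k => iterPoly (unicritical d c) k - X
  let D : ℕ → K[X] := fun k => ∏ α ∈ exactPeriodPoints d c k, (X - C α)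
  have hP : ∀ k, 0 < k → P k ≠ 0 := fun k hk =>
    (iterPoly_unicritical_sub_X_monic hd c hk.ne').ne_zero
  have hD : ∀ k, 0 < k → D k ≠ 0 := fun k _ => (monic_prod_X_sub_C _ _).ne_zero
  have key := (ArithmeticFunction.prod_eq_iff_prod_pow_moebius_eq_of_nonzero
    (f := fun k => ι (D k)) (g := fun k => ι (P k))
    (fun k hk => (map_ne_zero_iff ι hι).2 (hD k hk))
    (fun k hk => (map_ne_zero_iff ι hι).2 (hP k hk))).1
    (fun k hk => by rw [← map_prod]; exact congrArg ι (iterPoly_sub_X_eq_prod hd hc hk.ne').symm)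
    n (Nat.pos_of_ne_zero hn)
  have hmul : D n * (∏ k ∈ n.divisors with ArithmeticFunction.moebius (n / k) = -1, P k) =
      ∏ k ∈ n.divisors with ArithmeticFunction.moebius (n / k) = 1, P k := by
    apply hι
    rw [map_mul, ← key, map_prod, map_prod, Finset.prod_filter, Finset.prod_filter,
      Nat.prod_divisorsAntidiagonal' (fun i j => ι (P j) ^ ArithmeticFunction.moebius i),
      ← Finset.prod_mul_distrib]
    refine Finset.prod_congr rfl fun k hk => ?_
    have h0 : ι (P k) ≠ 0 := (map_ne_zero_iff ι hι).2 (hP k (Nat.pos_of_mem_divisors hk))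
    rcases ArithmeticFunction.moebius_eq_or (n / k) with h | h | h <;> simp [h, h0]
  have hmon : (∏ k ∈ n.divisors with ArithmeticFunction.moebius (n / k) = -1, P k).Monic := by
    refine monic_prod_of_monic _ _ fun k hk => iterPoly_unicritical_sub_X_monic hd c ?_
    exact (Nat.pos_of_mem_divisors (Finset.mem_filter.1 hk).1).ne'
  change (∏ k ∈ n.divisors with ArithmeticFunction.moebius (n / k) = 1, P k) /ₘ _ = D n
  rw [← hmul, mul_comm]
  exact mul_divByMonic_cancel_left _ hmon

end Field

/-! ### Tools: products over roots, orbit counting, descent of coefficients. -/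

/-- The polynomial `Res_z(g(z), x - h(z))`, that is, `∏ (x - h(α))` over the roots `α` of a monic
polynomial `g`. -/
noncomputable def rootImagePoly {R : Type*} [CommRing R] (g h : R[X]) : R[X] :=
  resultant (g.map C) (C X - h.map C) g.natDegree h.natDegree

/-- Resultants commute with ring homomorphisms, so the product over the roots can be formed over
ℤ[c] and then specialised anywhere. -/
theorem rootImagePoly_map {R K : Type*} [CommRing R] [Field K] [IsAlgClosed K] (φ : R →+* K)
    {g : R[X]} (hg : g.Monic) (h : R[X]) :
    (rootImagePoly g h).map φ = ((g.map φ).roots.map fun α => X - C ((h.map φ).eval α)).prod := by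
  have hs : (g.map φ).Splits := IsAlgClosed.splits _
  have hgφ : (g.map φ).Monic := hg.map φ
  have h1 : (rootImagePoly g h).map φ = resultant ((g.map φ).map (C : K →+* K[X]))
      (C X - (h.map φ).map C) ((g.map φ).map (C : K →+* K[X])).natDegree h.natDegree := by
    change mapRingHom φ (rootImagePoly g h) = _
    rw [rootImagePoly, ← resultant_map_map, natDegree_map_eq_of_injective C_injective,
      hg.natDegree_map]
    congr 1
    · rw [Polynomial.map_map, Polynomial.map_map]
      congr 1
      ext : 1
      simp
    · rw [Polynomial.map_sub, Polynomial.map_map, Polynomial.map_map]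
      congr 1
      · simp
      · congr 1
        ext : 1
        simp
  rw [h1, resultant_eq_prod_eval _ _ _ _ (hs.map C), (hgφ.map C).leadingCoeff, one_pow, one_mul,
    hs.roots_map_of_injective C_injective, Multiset.map_map]
  · congr 1
    refine Multiset.map_congr rfl fun α _ => ?_
    simp [eval_map, eval₂_at_apply]
  -- Only a degree bound is needed: h may lose degree under φ, harmlessly since g is monic.
  · refine (natDegree_sub_le _ _).trans ?_
    rw [natDegree_C, natDegree_map_eq_of_injective C_injective]
    simpa using natDegree_map_le

/-- S is a disjoint union of orbits, each with n elements. -/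
theorem card_dvd_of_minimalPeriod_eq {α : Type*} [DecidableEq α] {f : α → α} {S : Finset α} {n : ℕ}
    (hn : n ≠ 0) (hf : ∀ a ∈ S, f a ∈ S) (hS : ∀ a ∈ S, Function.minimalPeriod f a = n) :
    n ∣ S.card := by
  let orbit : α → Finset α := fun a => (Finset.range n).image fun i => f^[i] a
  have hit : ∀ a ∈ S, ∀ i, f^[i] a ∈ S := fun a ha i => by
    induction i with
    | zero => exact ha
    | succ i ih => rw [Function.iterate_succ_apply']; exact hf _ ih
  have hcard : ∀ a ∈ S, (orbit a).card = n := fun a ha => by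
    rw [Finset.card_image_of_injOn, Finset.card_range]
    have := Function.iterate_injOn_Iio_minimalPeriod (f := f) (x := a)
    rw [hS a ha] at this
    intro i hi j hj hij
    exact this (by simpa using hi) (by simpa using hj) hij
  have hself : ∀ a, a ∈ orbit a := fun a =>
    Finset.mem_image.2 ⟨0, by simpa using Nat.pos_of_ne_zero hn, rfl⟩
  have heq : ∀ b ∈ S, ∀ a ∈ orbit b, a ∈ S ∧ orbit a = orbit b := fun b hb a ha => by
    obtain ⟨i, -, rfl⟩ := Finset.mem_image.1 ha
    refine ⟨hit b hb i, Finset.eq_of_subset_of_card_le ?_ ?_⟩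
    · intro x hx
      obtain ⟨j, -, rfl⟩ := Finset.mem_image.1 hx
      refine Finset.mem_image.2 ⟨(j + i) % n, by simpa using Nat.mod_lt _ (Nat.pos_of_ne_zero hn), ?_⟩
      rw [← hS b hb, Function.iterate_mod_minimalPeriod_eq, Function.iterate_add_apply]
    · rw [hcard b hb, hcard _ (hit b hb i)]
  rw [Finset.card_eq_sum_card_image orbit S]
  refine Finset.dvd_sum fun o ho => ?_
  obtain ⟨b, hb, rfl⟩ := Finset.mem_image.1 ho
  have : {a ∈ S | orbit a = orbit b} = orbit b := by
    ext a
    rw [Finset.mem_filter]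
    exact ⟨fun h => h.2 ▸ hself a, heq b hb a⟩
  rw [this, hcard b hb]

theorem minimalPeriod_eq_of_semiconj {α : Type*} {f τ : α → α} (h : Function.Semiconj τ f f)
    (hτ : Function.Injective τ) (a : α) :
    Function.minimalPeriod f (τ a) = Function.minimalPeriod f a := by
  rw [Function.minimalPeriod_eq_minimalPeriod_iff]
  intro n
  simp only [Function.IsPeriodicPt, Function.IsFixedPt, ← (h.iterate_right n).eq, hτ.eq_iff]

/-- A polynomial over an extension of the fraction field `k` of an integrally closed domain `R`,
with coefficients in `k` and integral over `R`, comes from `R`. -/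
theorem exists_map_eq_of_isIntegral_coeff {R k K : Type*} [CommRing R] [IsDomain R]
    [IsIntegrallyClosed R] [Field k] [Algebra R k] [IsFractionRing R k] [Field K] [Algebra R K]
    [Algebra k K] [IsScalarTower R k K] {p : K[X]} (h1 : ∀ i, p.coeff i ∈ (algebraMap k K).range)
    (h2 : ∀ i, IsIntegral R (p.coeff i)) : ∃ q : R[X], q.map (algebraMap R K) = p := by
  refine (mem_lifts p).1 ((lifts_iff_coeff_lifts p).2 fun i => ?_)
  obtain ⟨y, hy⟩ := h1 i
  have hi : IsIntegral R y := by
    rw [← isIntegral_algebraMap_iff (algebraMap k K).injective, hy]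
    exact h2 i
  obtain ⟨x, rfl⟩ := IsIntegrallyClosed.isIntegral_iff.1 hi
  exact ⟨x, by rw [← hy, ← IsScalarTower.algebraMap_apply]⟩

theorem isIntegral_coeff_prod_X_sub_C {R K : Type*} [CommRing R] [Field K] [Algebra R K]
    {N : Multiset K} (hN : ∀ a ∈ N, IsIntegral R a) (i : ℕ) :
    IsIntegral R ((N.map fun a => X - C a).prod.coeff i) := by
  have h : (N.map fun a => X - C a).prod ∈ liftsRing (algebraMap (integralClosure R K) K) := by
    refine Subring.multiset_prod_mem _ _ fun p hp => ?_
    obtain ⟨a, ha, rfl⟩ := Multiset.mem_map.1 hp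
    exact ⟨X - C ⟨a, hN a ha⟩, by simp⟩
  obtain ⟨q, hq⟩ := h
  rw [← hq, coe_mapRingHom, coeff_map]
  exact (q.coeff i).2

/-! ### Multipliers on cycles: multiplicity, Galois symmetry, integrality. -/

section Field

variable {K : Type*} [Field K]

theorem isPeriodicPt_of_mem_exactPeriodPoints {d : ℕ} (hd : 2 ≤ d) {c : K} {n : ℕ} (hn : n ≠ 0)
    {α : K} (hα : α ∈ exactPeriodPoints d c n) :
    Function.IsPeriodicPt (fun w : K => w ^ d + c) n α := by
  rw [mem_exactPeriodPoints hd hn] at hα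
  exact hα ▸ Function.isPeriodicPt_minimalPeriod _ _

theorem apply_mem_exactPeriodPoints {d : ℕ} (hd : 2 ≤ d) {c : K} {n : ℕ} (hn : n ≠ 0) {α : K}
    (hα : α ∈ exactPeriodPoints d c n) : α ^ d + c ∈ exactPeriodPoints d c n := by
  have hper := isPeriodicPt_of_mem_exactPeriodPoints hd hn hα
  rw [mem_exactPeriodPoints hd hn] at hα ⊢
  rw [← hα]
  exact Function.minimalPeriod_apply ⟨n, Nat.pos_of_ne_zero hn, hper⟩

theorem multiplier_apply {d : ℕ} {c : K} {n : ℕ} {α : K}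
    (hα : Function.IsPeriodicPt (fun w : K => w ^ d + c) n α) :
    multiplier (unicritical d c) n (α ^ d + c) = multiplier (unicritical d c) n α := by
  rw [multiplier_unicritical, multiplier_unicritical]
  obtain _ | n := n
  · simp
  rw [Finset.prod_range_succ, Finset.prod_range_succ']
  have h1 : ∀ i, (fun w : K => w ^ d + c)^[i] (α ^ d + c) = (fun w : K => w ^ d + c)^[i + 1] α :=
    fun i => (Function.iterate_succ_apply _ _ _).symm
  simp only [Algebra.algebraMap_self, RingHom.id_apply, h1, hα.eq, Function.iterate_zero, id]

/-- Multipliers are constant on cycles, so that the multiset of multipliers at the points of exact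
period `n` is `n` times a multiset. -/
theorem exists_nsmul_eq_multipliers {d : ℕ} (hd : 2 ≤ d) (c : K) {n : ℕ} (hn : n ≠ 0) :
    ∃ N : Multiset K,
      (exactPeriodPoints d c n).val.map (multiplier (unicritical d c) n) = n • N := by
  classical
  refine Multiset.exists_smul_of_dvd_count _ fun a _ => ?_
  rw [Multiset.count_map, ← Finset.filter_val, Finset.card_val]
  -- The points with a given multiplier are stable under the map, so they form whole cycles of
  -- length n.
  refine card_dvd_of_minimalPeriod_eq (f := fun w : K => w ^ d + c) hn (fun α hα => ?_)
    fun α hα => ?_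
  · rw [Finset.mem_filter] at hα ⊢
    refine ⟨apply_mem_exactPeriodPoints hd hn hα.1, ?_⟩
    rw [multiplier_apply (isPeriodicPt_of_mem_exactPeriodPoints hd hn hα.1)]
    exact hα.2
  · exact (mem_exactPeriodPoints hd hn).1 (Finset.mem_filter.1 hα).1

/-- The multiset of multipliers at the points of exact period `n` is invariant under the
automorphisms fixing `d ^ d * c ^ (d - 1)`. -/
theorem map_multipliers_eq [CharZero K] {d : ℕ} (hd : 2 ≤ d) {c : K} (hc : c ≠ 0) {n : ℕ}
    (hn : n ≠ 0) (σ : K ≃+* K)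
    (hσ : σ ((d : K) ^ d * c ^ (d - 1)) = (d : K) ^ d * c ^ (d - 1)) :
    ((exactPeriodPoints d c n).val.map (multiplier (unicritical d c) n)).map σ =
      (exactPeriodPoints d c n).val.map (multiplier (unicritical d c) n) := by
  have hd0 : (d : K) ≠ 0 := Nat.cast_ne_zero.2 (by lia)
  obtain ⟨u, hu⟩ : ∃ u, u = c / σ c := ⟨_, rfl⟩
  have hσc : σ c ≠ 0 := (map_ne_zero_iff σ σ.injective).2 hc
  have hu0 : u ≠ 0 := hu ▸ div_ne_zero hc hσc
  have hcu : u * σ c = c := by rw [hu, div_mul_cancel₀ _ hσc]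
  -- Since σ fixes t and d ≠ 0 in K, it fixes c^(d-1).
  have hu1 : u ^ (d - 1) = 1 := by
    rw [map_mul, map_pow, map_pow, map_natCast] at hσ
    rw [hu, div_pow, mul_left_cancel₀ (pow_ne_zero _ hd0) hσ, div_self (pow_ne_zero _ hc)]
  have hud : u ^ d = u := by
    rw [← Nat.sub_add_cancel (show 1 ≤ d by lia), pow_succ, hu1, one_mul]
  let f : K → K := fun w => w ^ d + c
  let τ : K → K := fun w => u * σ w
  have hτ : Function.Injective τ := fun x y h => σ.injective (mul_left_cancel₀ hu0 h)
  have hsemi : Function.Semiconj τ f f := fun w => by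
    simp only [τ, f, map_add, map_pow, mul_add, hcu, mul_pow, hud]
  have hS : (exactPeriodPoints d c n).map ⟨τ, hτ⟩ = exactPeriodPoints d c n := by
    refine Finset.eq_of_subset_of_card_le (fun x hx => ?_) (Finset.card_map _).ge
    obtain ⟨α, hα, rfl⟩ := Finset.mem_map.1 hx
    rw [mem_exactPeriodPoints hd hn] at hα ⊢
    exact (minimalPeriod_eq_of_semiconj hsemi hτ α).trans hα
  have hω : ∀ α, multiplier (unicritical d c) n (τ α) = σ (multiplier (unicritical d c) n α) := by
    intro α
    rw [multiplier_unicritical, multiplier_unicritical, map_prod]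
    refine Finset.prod_congr rfl fun i _ => ?_
    have : (fun w : K => w ^ d + c)^[i] (τ α) = u * σ ((fun w : K => w ^ d + c)^[i] α) :=
      ((hsemi.iterate_right i).eq α).symm
    simp only [Algebra.algebraMap_self, RingHom.id_apply] at this ⊢
    rw [this, mul_pow, hu1, one_mul, map_mul, map_pow, map_natCast]
  nth_rw 2 [← hS]
  rw [Finset.map_val, Multiset.map_map, Multiset.map_map]
  exact Multiset.map_congr rfl fun α _ => (hω α).symm

/-- Converse of `isIntegral_of_isIntegral_multiplier`: the cyclic system of the w_i now has integral
coefficients. -/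
theorem isIntegral_multiplier [IsAlgClosed K] {R : Type*} [CommRing R] [Algebra R K] {d m : ℕ}
    (hd : 2 ≤ d) (hm : 0 < m) {c z : K} (hc : IsIntegral R ((d : K) ^ d * c ^ (d - 1)))
    (hz : Function.IsPeriodicPt (fun w : K => w ^ d + c) m z) :
    IsIntegral R (multiplier (unicritical d c) m z) := by
  obtain ⟨b, hb⟩ := exists_pow_pred_eq hd (d : K)
  rw [← rescaled_const_pow hd hb] at hc
  have hdint : IsIntegral R (d : K) := by
    simpa using isIntegral_algebraMap (R := R) (A := K) (x := (d : R))
  rw [multiplier_eq_prod_rescaled hb]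
  refine IsIntegral.prod _ fun i _ => IsIntegral.pow ?_ _
  exact isIntegral_of_periodic_of_pow_eq hd hm hdint (hc.of_pow (by lia)).neg
    (periodic_rescaled hz b) (rescaled_iterate_pow hd hb c z) i

end Field

/-! ### The universal multiplier polynomial over ℤ[t]. -/

theorem eval₂RingHom_int_X {S : Type*} [CommRing S] (x : S) :
    eval₂RingHom (Int.castRingHom S) x X = x := by
  simp

theorem comp_eval₂RingHom_int {R S : Type*} [CommRing R] [CommRing S] (φ : R →+* S) (x : R) :
    φ.comp (eval₂RingHom (Int.castRingHom R) x) = eval₂RingHom (Int.castRingHom S) (φ x) :=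
  ringHom_ext' (Subsingleton.elim _ _) (by simp)

/-- Here `X` is t. One multiplier per cycle gives a Galois-stable multiset N; its polynomial has
coefficients in ℚ(t), integral over ℤ[t], hence in ℤ[t]. -/
theorem exists_universal_over_algebraicClosure {k K : Type*} [Field k] [Field K] [Algebra ℤ[X] k]
    [IsFractionRing ℤ[X] k] [Algebra k K] [Algebra ℤ[X] K] [IsScalarTower ℤ[X] k K]
    [IsAlgClosure k K] {d : ℕ} (hd : 2 ≤ d) {m : ℕ} (hm : m ≠ 0) {c : K}
    (hc : (d : K) ^ d * c ^ (d - 1) = algebraMap ℤ[X] K X) :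
    ∃ D : ℤ[X][X], D.map (algebraMap ℤ[X] K) ^ m =
      ((exactPeriodPoints d c m).val.map fun α => X - C (multiplier (unicritical d c) m α)).prod ∧
      D.Monic := by
  have : IsAlgClosed K := IsAlgClosure.isAlgClosed k
  have : CharZero k := charZero_of_injective_algebraMap (IsFractionRing.injective ℤ[X] k)
  have : CharZero K := charZero_of_injective_algebraMap (algebraMap k K).injective
  have hinj : Function.Injective (algebraMap ℤ[X] K) := by
    rw [IsScalarTower.algebraMap_eq ℤ[X] k K]
    exact (algebraMap k K).injective.comp (IsFractionRing.injective ℤ[X] k)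
  have hc0 : c ≠ 0 := by
    rintro rfl
    rw [zero_pow (by lia), mul_zero, eq_comm, map_eq_zero_iff _ hinj] at hc
    exact X_ne_zero hc
  obtain ⟨N, hN⟩ := exists_nsmul_eq_multipliers hd c hm
  have hNint : ∀ a ∈ N, IsIntegral ℤ[X] a := by
    intro a ha
    have : a ∈ m • N := (Multiset.mem_nsmul_of_ne_zero hm).2 ha
    rw [← hN] at this
    obtain ⟨α, hα, rfl⟩ := Multiset.mem_map.1 this
    refine isIntegral_multiplier hd (Nat.pos_of_ne_zero hm) ?_
      (isPeriodicPt_of_mem_exactPeriodPoints hd hm hα)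
    rw [hc]
    exact isIntegral_algebraMap
  have hNσ : ∀ σ : K ≃ₐ[k] K, N.map σ = N := by
    intro σ
    have h := map_multipliers_eq hd hc0 hm σ.toRingEquiv (by
      rw [hc, IsScalarTower.algebraMap_apply ℤ[X] k K]
      exact σ.commutes _)
    rw [hN, Multiset.map_nsmul] at h
    exact nsmul_right_injective hm h
  obtain ⟨D, hD⟩ := exists_map_eq_of_isIntegral_coeff (R := ℤ[X]) (k := k)
    (p := (N.map fun a => X - C a).prod) (fun i => by
      refine (InfiniteGalois.mem_range_algebraMap_iff_fixed _).2 fun σ => ?_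
      have : ((N.map fun a => X - C a).prod).map (σ : _ →+* _) = (N.map fun a => X - C a).prod := by
        rw [Polynomial.map_multiset_prod, Multiset.map_map]
        conv_rhs => rw [← hNσ σ, Multiset.map_map]
        simp
      conv_rhs => rw [← this, coeff_map]
      rfl) (isIntegral_coeff_prod_X_sub_C hNint)
  refine ⟨D, ?_, monic_of_injective hinj ?_⟩
  · rw [hD, ← Multiset.prod_nsmul, ← Multiset.map_nsmul, ← hN, Multiset.map_map]
    rfl
  · rw [hD]
    exact monic_multiset_prod_of_monic _ _ fun a _ => monic_X_sub_C a

/-- As t is transcendental, so is c; identities over ℤ[c] may thus be checked in K. -/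
theorem injective_eval₂RingHom_of_transcendental {K : Type*} [Field K] [CharZero K]
    [Algebra ℤ[X] K] (hinj : Function.Injective (algebraMap ℤ[X] K)) {d : ℕ} {c : K}
    (hc : (d : K) ^ d * c ^ (d - 1) = algebraMap ℤ[X] K X) :
    Function.Injective (eval₂RingHom (Int.castRingHom K) c) ∧
      ¬ IsIntegral ℤ ((d : K) ^ d * c ^ (d - 1)) := by
  have htr : ¬ IsAlgebraic ℤ ((d : K) ^ d * c ^ (d - 1)) := by
    rintro ⟨p, hp, h⟩
    refine hp (hinj ?_)
    rw [map_zero, ← h, hc, aeval_algebraMap_apply, aeval_X_left_apply]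
  refine ⟨?_, fun h => htr h.isAlgebraic⟩
  have hctr : Transcendental ℤ c := fun h => htr
    (.mul (by simpa using (isAlgebraic_algebraMap (R := ℤ) (A := K) (d : ℤ)).pow d) (h.pow _))
  rw [transcendental_iff_injective] at hctr
  exact hctr

theorem exists_universal_of_isAlgClosure {k K : Type*} [Field k] [Field K] [Algebra ℤ[X] k]
    [IsFractionRing ℤ[X] k] [Algebra k K] [Algebra ℤ[X] K] [IsScalarTower ℤ[X] k K]
    [IsAlgClosure k K] {d : ℕ} (hd : 2 ≤ d) {m : ℕ} (hm : m ≠ 0) :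
    ∃ D : ℤ[X][X], D.Monic ∧ (dynatomic (unicritical d (X : ℤ[X])) m).Monic ∧
      D.map (eval₂RingHom (Int.castRingHom ℤ[X]) ((d : ℤ[X]) ^ d * X ^ (d - 1))) ^ m =
        rootImagePoly (dynatomic (unicritical d (X : ℤ[X])) m)
          (derivative (iterPoly (unicritical d (X : ℤ[X])) m)) := by
  have : IsAlgClosed K := IsAlgClosure.isAlgClosed k
  have hinj : Function.Injective (algebraMap ℤ[X] K) := by
    rw [IsScalarTower.algebraMap_eq ℤ[X] k K]
    exact (algebraMap k K).injective.comp (IsFractionRing.injective ℤ[X] k)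
  have : CharZero K := charZero_of_injective_algebraMap hinj
  have hd0 : (d : K) ≠ 0 := Nat.cast_ne_zero.2 (by lia)
  obtain ⟨c, hc'⟩ := exists_pow_pred_eq hd (algebraMap ℤ[X] K X / d ^ d)
  have hc : (d : K) ^ d * c ^ (d - 1) = algebraMap ℤ[X] K X := by
    rw [hc', mul_div_cancel₀ _ (pow_ne_zero _ hd0)]
  obtain ⟨hψ, hint⟩ := injective_eval₂RingHom_of_transcendental hinj hc
  obtain ⟨ψ, hψ_eq⟩ : ∃ ψ, ψ = eval₂RingHom (Int.castRingHom K) c := ⟨_, rfl⟩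
  rw [← hψ_eq] at hψ
  have hψX : ψ X = c := by rw [hψ_eq, eval₂RingHom_int_X]
  obtain ⟨D, hD, hDmon⟩ := exists_universal_over_algebraicClosure (k := k) hd hm hc
  have hf : (unicritical d (X : ℤ[X])).Monic := unicritical_monic (by lia) _
  have hf2 : 2 ≤ (unicritical d (X : ℤ[X])).natDegree := by rwa [natDegree_unicritical]
  have hdyn := dynatomic_map ψ hf hf2 (n := m)
  rw [unicritical_map, hψX, dynatomic_eq_prod hd hint hm] at hdyn
  have hdynmon : (dynatomic (unicritical d (X : ℤ[X])) m).Monic := by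
    refine monic_of_injective hψ ?_
    rw [hdyn]
    exact monic_prod_X_sub_C _ _
  refine ⟨D, hDmon, hdynmon, Polynomial.map_injective ψ hψ ?_⟩
  have hcomp : ψ.comp (eval₂RingHom (Int.castRingHom ℤ[X]) ((d : ℤ[X]) ^ d * X ^ (d - 1))) =
      algebraMap ℤ[X] K := by
    rw [comp_eval₂RingHom_int]
    exact ringHom_ext' (Subsingleton.elim _ _) (by simp [hψX, hc])
  rw [rootImagePoly_map ψ hdynmon, hdyn, roots_prod_X_sub_C, Polynomial.map_pow, Polynomial.map_map,
    ← derivative_map, iterPoly_map, unicritical_map, hψX, hcomp, hD]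
  simp [multiplier]

/-- The multiplier polynomials of `z ^ d + c` over `ℤ[c]` are polynomials in `d ^ d * c ^ (d - 1)`
over `ℤ`. -/
theorem exists_universal {d : ℕ} (hd : 2 ≤ d) {m : ℕ} (hm : m ≠ 0) :
    ∃ D : ℤ[X][X], D.Monic ∧ (dynatomic (unicritical d (X : ℤ[X])) m).Monic ∧
      D.map (eval₂RingHom (Int.castRingHom ℤ[X]) ((d : ℤ[X]) ^ d * X ^ (d - 1))) ^ m =
        rootImagePoly (dynatomic (unicritical d (X : ℤ[X])) m)
          (derivative (iterPoly (unicritical d (X : ℤ[X])) m)) :=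
  exists_universal_of_isAlgClosure (k := FractionRing ℤ[X])
    (K := AlgebraicClosure (FractionRing ℤ[X])) hd hm

/-! ### Specialisation to arbitrary fields and to O[c]. -/

section Specialization

/-- The polynomial over `ℤ[t]` whose value at `t = d ^ d * c ^ (d - 1)` is the `m`-th multiplier
polynomial of `z ^ d + c`. -/
noncomputable def universalMultiplierPoly {d : ℕ} (hd : 2 ≤ d) {m : ℕ} (hm : m ≠ 0) : ℤ[X][X] :=
  (exists_universal hd hm).choose

variable {d : ℕ} (hd : 2 ≤ d) {m : ℕ} (hm : m ≠ 0)

theorem universalMultiplierPoly_monic : (universalMultiplierPoly hd hm).Monic :=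
  (exists_universal hd hm).choose_spec.1

/-- The value at a parameter `c` of the universal multiplier polynomial. -/
theorem universalMultiplierPoly_map_pow {K : Type*} [Field K] [IsAlgClosed K] (c : K) :
    (universalMultiplierPoly hd hm).map
        (eval₂RingHom (Int.castRingHom K) ((d : K) ^ d * c ^ (d - 1))) ^ m =
      ((dynatomic (unicritical d c) m).roots.map
        fun α => X - C (multiplier (unicritical d c) m α)).prod := by
  obtain ⟨-, hdyn, h⟩ := (exists_universal hd hm).choose_spec
  obtain ⟨ψ, hψX⟩ : ∃ ψ : ℤ[X] →+* K, ψ X = c := ⟨_, eval₂RingHom_int_X c⟩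
  have hf : (unicritical d (X : ℤ[X])).Monic := unicritical_monic (by lia) _
  have hf2 : 2 ≤ (unicritical d (X : ℤ[X])).natDegree := by rwa [natDegree_unicritical]
  have h' := congrArg (Polynomial.map ψ) h
  rw [rootImagePoly_map ψ hdyn, Polynomial.map_pow, Polynomial.map_map, dynatomic_map ψ hf hf2,
    ← derivative_map, iterPoly_map, unicritical_map, hψX] at h'
  rw [comp_eval₂RingHom_int, map_mul, map_pow, map_pow, map_natCast, hψX] at h'
  exact h'

/-- Over an algebraic closure, n times the two root multisets agree, so the multisets agree. The
argument is independent of the characteristic. -/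
theorem pow_injective_of_monic {R : Type*} [CommRing R] [IsDomain R] {p q : R[X]} (hp : p.Monic)
    (hq : q.Monic) {n : ℕ} (hn : n ≠ 0) (h : p ^ n = q ^ n) : p = q := by
  let L := AlgebraicClosure (FractionRing R)
  have hinj : Function.Injective (algebraMap R L) :=
    algebraMap_algebraicClosure_fractionRing_injective R
  refine Polynomial.map_injective _ hinj ?_
  have h' := congrArg (fun p => (p.map (algebraMap R L)).roots) h
  simp only [Polynomial.map_pow, roots_pow] at h'
  rw [(IsAlgClosed.splits (p.map (algebraMap R L))).eq_prod_roots_of_monic (hp.map _),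
    (IsAlgClosed.splits (q.map (algebraMap R L))).eq_prod_roots_of_monic (hq.map _),
    nsmul_right_injective hn h']

/-- The multiplier polynomial of `z ^ d + c` over `O[c]` is the value of the universal one at
`d ^ d * c ^ (d - 1)`. -/
theorem multiplierPoly_unicritical (O : Type*) [CommRing O] [IsDomain O] :
    multiplierPoly (unicritical d (X : O[X])) m =
      (universalMultiplierPoly hd hm).map
        (eval₂RingHom (Int.castRingHom O[X]) ((d : O[X]) ^ d * X ^ (d - 1))) := by
  let L := AlgebraicClosure (FractionRing O[X])
  have hinj : Function.Injective (algebraMap O[X] L) :=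
    algebraMap_algebraicClosure_fractionRing_injective O[X]
  have hf : (unicritical d (X : O[X])).Monic := unicritical_monic (by lia) _
  have hf2 : 2 ≤ (unicritical d (X : O[X])).natDegree := by rwa [natDegree_unicritical]
  have key : IsMultiplierPoly (unicritical d (X : O[X])) m
      ((universalMultiplierPoly hd hm).map
        (eval₂RingHom (Int.castRingHom O[X]) ((d : O[X]) ^ d * X ^ (d - 1)))) := by
    refine ⟨(universalMultiplierPoly_monic hd hm).map _, ?_⟩
    rw [Polynomial.map_map, comp_eval₂RingHom_int, map_mul, map_pow, map_pow, map_natCast,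
      universalMultiplierPoly_map_pow, multiplierProd, aroots_def, dynatomic_map _ hf hf2,
      unicritical_map]
    have hmult : ∀ α : L, multiplier (unicritical d (X : O[X])) m α =
        multiplier (unicritical d (algebraMap O[X] L X)) m α := fun α => by
      rw [← multiplier_map, unicritical_map]
    simp only [hmult]
    rfl
  have hex : ∃ δ, IsMultiplierPoly (unicritical d (X : O[X])) m δ := ⟨_, key⟩
  rw [multiplierPoly, dif_pos hex]
  refine pow_injective_of_monic hex.choose_spec.1 key.1 hm (Polynomial.map_injective _ hinj ?_)
  rw [Polynomial.map_pow, Polynomial.map_pow, hex.choose_spec.2, key.2]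

end Specialization

/-! ### Expansion at t = ∞. -/

theorem scaleRoots_prod_X_sub_C {K : Type*} [Field K] (s : K) (N : Multiset K) :
    (N.map fun a => X - C a).prod.scaleRoots s = (N.map fun a => X - C (s * a)).prod := by
  induction N using Multiset.induction with
  | empty => simp
  | cons a N ih =>
    rw [Multiset.map_cons, Multiset.prod_cons, mul_scaleRoots_of_noZeroDivisors, ih,
      Multiset.map_cons, Multiset.prod_cons]
    rw [X_sub_C_scaleRoots, mul_comm a s]

/-- `x` is congruent to `1` or to `-1` modulo `ξ`, in the integral closure of `R`. -/
def IsSignMod (R : Type*) {K : Type*} [CommRing R] [CommRing K] [Algebra R K] (ξ x : K) : Prop :=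
  ∃ ε : ℤ, IsUnit ε ∧ ∃ u : K, IsIntegral R u ∧ x = ε + ξ * u

section IsSignMod

variable {R K : Type*} [CommRing R] [CommRing K] [Algebra R K] {ξ x y : K}

theorem IsSignMod.one : IsSignMod R ξ 1 :=
  ⟨1, isUnit_one, 0, isIntegral_zero, by simp⟩

theorem IsSignMod.neg_one : IsSignMod R ξ (-1) :=
  ⟨-1, isUnit_one.neg, 0, isIntegral_zero, by simp⟩

theorem IsSignMod.mul (hξ : IsIntegral R ξ) (hx : IsSignMod R ξ x) (hy : IsSignMod R ξ y) :
    IsSignMod R ξ (x * y) := by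
  obtain ⟨ε, hε, u, hu, rfl⟩ := hx
  obtain ⟨ε', hε', u', hu', rfl⟩ := hy
  refine ⟨ε * ε', hε.mul hε', ε * u' + ε' * u + ξ * (u * u'), ?_, by push_cast; ring⟩
  exact (((isIntegral_intCast (R := R) ε).mul hu').add ((isIntegral_intCast (R := R) ε').mul hu)).add
    (hξ.mul (hu.mul hu'))

theorem IsSignMod.pow (hξ : IsIntegral R ξ) (hx : IsSignMod R ξ x) (n : ℕ) :
    IsSignMod R ξ (x ^ n) := by
  induction n with
  | zero => simpa using IsSignMod.one
  | succ n ih => rw [pow_succ]; exact ih.mul hξ hx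

end IsSignMod

theorem le_of_mul_X_pow_eq {R : Type*} [CommRing R] {g h : R[X]} {a b : ℕ}
    (e : h * X ^ a = g * X ^ b) (h0 : h.coeff 0 ≠ 0) : b ≤ a := by
  by_contra! hlt
  refine h0 ?_
  have := congrArg (fun p => p.coeff a) e
  simpa [coeff_mul_X_pow', hlt.not_ge] using this

section Field

variable {K : Type*} [Field K]

/-- With 1/t = X^n, reversing p amounts to clearing the pole of p(t) at t = ∞. -/
theorem algebraMap_expand_reverse [Algebra ℤ[X] K] {n : ℕ} {t : K}
    (ht : t * algebraMap ℤ[X] K X ^ n = 1) (p : ℤ[X]) :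
    algebraMap ℤ[X] K (expand ℤ n p.reverse) =
      eval₂ (Int.castRingHom K) t p * algebraMap ℤ[X] K X ^ (n * p.natDegree) := by
  have ht0 : t ≠ 0 := left_ne_zero_of_mul_eq_one ht
  let _ := invertibleOfNonzero ht0
  have hinv : ⅟t = algebraMap ℤ[X] K X ^ n := by
    rw [invOf_eq_inv]
    exact inv_eq_of_mul_eq_one_right ht
  have hev : algebraMap ℤ[X] K (expand ℤ n p.reverse) =
      eval₂ (Int.castRingHom K) (⅟t) p.reverse := by
    rw [hinv]
    exact congrArg (fun φ : ℤ[X] →+* K => φ p.reverse)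
      (ringHom_ext' (f := (algebraMap ℤ[X] K).comp (expand ℤ n).toRingHom)
        (g := eval₂RingHom (Int.castRingHom K) (algebraMap ℤ[X] K X ^ n))
        (Subsingleton.elim _ _) (by simp))
  rw [hev, ← eval₂_reverse_mul_pow (Int.castRingHom K) t p, mul_assoc, pow_mul, ← hinv,
    ← mul_pow, mul_invOf_self, one_pow, mul_one]

/-- An element of `K` integral over `ℤ[X]` and in its fraction field comes from `ℤ[X]`. -/
theorem exists_algebraMap_eq {k : Type*} [Field k] [Algebra ℤ[X] k] [IsFractionRing ℤ[X] k]
    [Algebra k K] [Algebra ℤ[X] K] [IsScalarTower ℤ[X] k K] {x : K} (hx : x ∈ (algebraMap k K).range)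
    (hi : IsIntegral ℤ[X] x) : ∃ g : ℤ[X], algebraMap ℤ[X] K g = x := by
  obtain ⟨y, rfl⟩ := hx
  obtain ⟨g, rfl⟩ := IsIntegrallyClosed.isIntegral_iff.1
    ((isIntegral_algebraMap_iff (algebraMap k K).injective).1 hi)
  exact ⟨g, IsScalarTower.algebraMap_apply _ _ _ _⟩

/-- At a parameter `c` with `d b c = ξ ^ (-d)`, where `b ^ (d - 1) = d`, the multipliers become
integral after multiplication by `ξ ^ (m (d - 1))`, and their `d`-th powers are then congruent to
`1` or to `-1` modulo `ξ`. -/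
theorem isIntegral_and_isSignMod_multiplier [IsAlgClosed K] {R : Type*} [CommRing R] [Algebra R K]
    {d m : ℕ} (hd : 2 ≤ d) (hm : 0 < m) {b c z ξ : K} (hb : b ^ (d - 1) = d)
    (hξ : IsIntegral R ξ) (hc : ξ ^ d * (d * b * c) = 1)
    (hz : Function.IsPeriodicPt (fun w : K => w ^ d + c) m z) :
    IsIntegral R (ξ ^ (m * (d - 1)) * multiplier (unicritical d c) m z) ∧
      IsSignMod R ξ ((ξ ^ (m * (d - 1)) * multiplier (unicritical d c) m z) ^ d) := by
  obtain ⟨y, hy⟩ : ∃ y : ℕ → K, y = fun i => ξ * (b * (fun w : K => w ^ d + c)^[i] z) := ⟨_, rfl⟩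
  have hyper : Function.Periodic y m := fun i => by
    rw [hy]
    exact congrArg (ξ * ·) (periodic_rescaled hz b i)
  have hyd : ∀ i, y i ^ d = d * ξ ^ (d - 1) * y (i + 1) + -1 := fun i => by
    have h1 : ξ ^ d = ξ ^ (d - 1) * ξ := by rw [← pow_succ, Nat.sub_add_cancel (by lia)]
    simp only [hy]
    rw [mul_pow, rescaled_iterate_pow hd hb, mul_add, mul_neg, hc, h1]
    ring
  have hdint : IsIntegral R (d : K) := isIntegral_natCast d
  have hyint : ∀ i, IsIntegral R (y i) := isIntegral_of_periodic_of_pow_eq hd hm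
    (hdint.mul (hξ.pow _)) isIntegral_one.neg hyper hyd
  have hprod : ξ ^ (m * (d - 1)) * multiplier (unicritical d c) m z =
      ∏ i ∈ Finset.range m, y i ^ (d - 1) := by
    rw [multiplier_eq_prod_rescaled hb, hy]
    simp only [mul_pow _ _ (d - 1)]
    rw [Finset.prod_mul_distrib (f := fun _ => ξ ^ (d - 1)), Finset.prod_const, Finset.card_range,
      ← pow_mul, mul_comm m]
  rw [hprod]
  refine ⟨IsIntegral.prod _ fun i _ => (hyint i).pow _, ?_⟩
  rw [← Finset.prod_pow]
  refine Finset.prod_induction _ (IsSignMod R ξ) (fun _ _ => IsSignMod.mul hξ) .one fun i _ => ?_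
  -- Exchanging exponents exposes y_i^d = -1 + ξ (d ξ^(d-2) y_{i+1}), where d ≥ 2 is used.
  rw [pow_right_comm, hyd]
  refine IsSignMod.pow hξ ⟨-1, isUnit_one.neg, d * ξ ^ (d - 2) * y (i + 1),
    (hdint.mul (hξ.pow _)).mul (hyint _), ?_⟩ _
  have h1 : ξ ^ (d - 1) = ξ ^ (d - 2) * ξ := by rw [← pow_succ]; congr 1; lia
  rw [h1]
  push_cast
  ring

theorem inv_mem_range {k : Type*} [Field k] [Algebra k K] {x : K}
    (hx : x ∈ (algebraMap k K).range) : x⁻¹ ∈ (algebraMap k K).range := by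
  obtain ⟨y, rfl⟩ := hx
  exact ⟨y⁻¹, map_inv₀ _ _⟩

/-- Expansion of the coefficients at `t = ∞`: in terms of a root `X` of `1 / t` of order
`d (d - 1)`, rescaling the multipliers by `X ^ (m (d - 1))` gives a polynomial `G` over `ℤ[X]`
whose constant coefficient is `±1` at `X = 0`. -/
theorem universalMultiplierPoly_expansion {k : Type*} [Field k] [Algebra ℤ[X] k]
    [IsFractionRing ℤ[X] k] [Algebra k K] [Algebra ℤ[X] K] [IsScalarTower ℤ[X] k K] [IsAlgClosure k K]
    {d : ℕ} (hd : 2 ≤ d) {m : ℕ} (hm : m ≠ 0) :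
    ∃ G : ℤ[X][X],
      (∀ j, expand ℤ (d * (d - 1)) ((universalMultiplierPoly hd hm).coeff j).reverse *
            X ^ (m * (d - 1) * ((universalMultiplierPoly hd hm).natDegree - j)) =
          G.coeff j * X ^ (d * (d - 1) * ((universalMultiplierPoly hd hm).coeff j).natDegree)) ∧
      IsUnit ((G.coeff 0).coeff 0) := by
  have : IsAlgClosed K := IsAlgClosure.isAlgClosed k
  have hinj : Function.Injective (algebraMap ℤ[X] K) := by
    rw [IsScalarTower.algebraMap_eq ℤ[X] k K]
    exact (algebraMap k K).injective.comp (IsFractionRing.injective ℤ[X] k)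
  have : CharZero K := charZero_of_injective_algebraMap hinj
  obtain ⟨D, hD⟩ : ∃ D, D = universalMultiplierPoly hd hm := ⟨_, rfl⟩
  have hDmon : D.Monic := hD ▸ universalMultiplierPoly_monic hd hm
  obtain ⟨ξ, hξ⟩ : ∃ ξ, ξ = algebraMap ℤ[X] K X := ⟨_, rfl⟩
  have hξ0 : ξ ≠ 0 := by
    rw [hξ]
    exact (map_ne_zero_iff _ hinj).2 X_ne_zero
  have hξint : IsIntegral ℤ[X] ξ := hξ ▸ isIntegral_algebraMap
  have hrange : ∀ g : ℤ[X], algebraMap ℤ[X] K g ∈ (algebraMap k K).range := fun g =>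
    ⟨algebraMap ℤ[X] k g, (IsScalarTower.algebraMap_apply ℤ[X] k K g).symm⟩
  have hξk : ξ ∈ (algebraMap k K).range := hξ ▸ hrange X
  have hd0 : (d : K) ≠ 0 := Nat.cast_ne_zero.2 (by lia)
  obtain ⟨b, hb⟩ := exists_pow_pred_eq hd (d : K)
  have hb0 : b ≠ 0 := by
    rintro rfl
    rw [zero_pow (by lia)] at hb
    exact hd0 hb.symm
  obtain ⟨c, hc⟩ : ∃ c : K, ξ ^ d * (d * b * c) = 1 :=
    ⟨(ξ ^ d * (d * b))⁻¹, by field_simp⟩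
  obtain ⟨t, ht⟩ : ∃ t, t = (d : K) ^ d * c ^ (d - 1) := ⟨_, rfl⟩
  have htξ : t * ξ ^ (d * (d - 1)) = 1 := by
    rw [ht, ← rescaled_const_pow hd hb, pow_mul, ← mul_pow, mul_comm, hc, one_pow]
  have htk : t ∈ (algebraMap k K).range := by
    rw [eq_inv_of_mul_eq_one_left htξ]
    exact inv_mem_range (pow_mem hξk _)
  -- If t were integral it would lie in ℤ[X], but t X^(d(d-1)) = 1 and X is not a unit there.
  have htint : ¬ IsIntegral ℤ t := by
    intro h
    obtain ⟨g, hg⟩ := exists_algebraMap_eq htk (h.tower_top (A := ℤ[X]))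
    rw [← hg, hξ, ← map_pow, ← map_mul, ← map_one (algebraMap ℤ[X] K)] at htξ
    have h1 := hinj htξ
    have h2 := congrArg (fun p => p.coeff 0) h1
    have h3 : d * (d - 1) ≠ 0 := Nat.mul_ne_zero (by lia) (by lia)
    rw [coeff_mul_X_pow', if_neg fun h => h3 (Nat.le_zero.1 h), coeff_one_zero] at h2
    exact zero_ne_one h2
  obtain ⟨ev, hev⟩ : ∃ ev, ev = eval₂RingHom (Int.castRingHom K) t := ⟨_, rfl⟩
  have hpow := universalMultiplierPoly_map_pow hd hm c
  rw [← ht, ← hev, ← hD, dynatomic_eq_prod hd (ht ▸ htint) hm, roots_prod_X_sub_C] at hpow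
  have hmul : ∀ a ∈ (D.map ev).roots, IsIntegral ℤ[X] (ξ ^ (m * (d - 1)) * a) ∧
      IsSignMod ℤ[X] ξ ((ξ ^ (m * (d - 1)) * a) ^ d) := by
    intro a ha
    have h0 : eval a (D.map ev ^ m) = 0 := by
      rw [eval_pow, (isRoot_of_mem_roots ha).eq_zero, zero_pow hm]
    rw [hpow, eval_multiset_prod, Multiset.prod_eq_zero_iff, Multiset.map_map] at h0
    obtain ⟨α, hα, h1⟩ := Multiset.mem_map.1 h0
    have h2 : a = multiplier (unicritical d c) m α := by simpa [sub_eq_zero] using h1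
    rw [h2]
    exact isIntegral_and_isSignMod_multiplier hd (Nat.pos_of_ne_zero hm) hb hξint hc
      (isPeriodicPt_of_mem_exactPeriodPoints hd hm hα)
  -- P has the rescaled multipliers as roots, so its coefficients are integral over ℤ[X].
  obtain ⟨P, hP⟩ : ∃ P, P = (D.map ev).scaleRoots (ξ ^ (m * (d - 1))) := ⟨_, rfl⟩
  have hPprod : P = ((D.map ev).roots.map fun a => X - C (ξ ^ (m * (d - 1)) * a)).prod := by
    rw [← scaleRoots_prod_X_sub_C, hP,
      ← (IsAlgClosed.splits (D.map ev)).eq_prod_roots_of_monic (hDmon.map ev)]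
  have hPcoeff : ∀ j, P.coeff j =
      eval₂ (Int.castRingHom K) t (D.coeff j) * ξ ^ (m * (d - 1) * (D.natDegree - j)) := by
    intro j
    rw [hP, coeff_scaleRoots, coeff_map, hDmon.natDegree_map, hev, ← pow_mul]
    rfl
  obtain ⟨G, hG⟩ := exists_map_eq_of_isIntegral_coeff (R := ℤ[X]) (k := k) (p := P) (fun j => by
      rw [hPcoeff]
      refine mul_mem ?_ (pow_mem hξk _)
      obtain ⟨t', rfl⟩ := htk
      exact ⟨eval₂ (Int.castRingHom k) t' (D.coeff j), by
        rw [hom_eval₂]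
        congr 1
        exact Subsingleton.elim _ _⟩) (fun j => by
      rw [hPprod, ← Function.comp_def (fun a => X - C a), ← Multiset.map_map]
      refine isIntegral_coeff_prod_X_sub_C (fun a ha => ?_) j
      obtain ⟨a', ha', rfl⟩ := Multiset.mem_map.1 ha
      exact (hmul a' ha').1)
  refine ⟨G, fun j => hinj ?_, ?_⟩
  · rw [← hD, map_mul, map_mul, ← coeff_map, hG, hPcoeff, map_pow, map_pow, ← hξ,
      algebraMap_expand_reverse (hξ ▸ htξ), ← hξ]
    ring
  have hsign : IsSignMod ℤ[X] ξ (P.coeff 0 ^ d) := by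
    rw [hPprod, coeff_zero_eq_eval_zero, eval_multiset_prod, ← Multiset.prod_map_pow]
    refine Multiset.prod_induction (IsSignMod ℤ[X] ξ) _ (fun _ _ => IsSignMod.mul hξint) .one ?_
    intro x hx
    simp only [Multiset.map_map, Multiset.mem_map, Function.comp_apply] at hx
    obtain ⟨a, ha, rfl⟩ := hx
    rw [eval_sub, eval_X, eval_C, zero_sub, neg_pow]
    exact (IsSignMod.neg_one.pow hξint d).mul hξint (hmul a ha).2
  obtain ⟨ε, hε, u, hu, heq⟩ := hsign
  rw [← hG, coeff_map] at heq
  -- u is integral and is a quotient of elements of ℤ[X], hence lies in ℤ[X]; the congruence modulo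
  -- ξ can then be read at X = 0.
  obtain ⟨v, rfl⟩ := exists_algebraMap_eq (k := k) (x := u) (by
    have hu' : u = (algebraMap ℤ[X] K (G.coeff 0) ^ d - ε) * ξ⁻¹ := by
      rw [heq]
      field_simp
      ring
    rw [hu']
    refine mul_mem (sub_mem (pow_mem (hrange _) _) (intCast_mem _ _))
      (inv_mem_range hξk)) hu
  have heq' : G.coeff 0 ^ d = (ε : ℤ[X]) + X * v := hinj (by simpa [hξ] using heq)
  have h0 := congrArg (eval 0) heq'
  simp only [eval_pow, eval_add, eval_mul, eval_X, zero_mul, add_zero,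
    eval_intCast] at h0
  rw [coeff_zero_eq_eval_zero]
  refine (isUnit_pow_iff (n := d) (by lia)).1 ?_
  rw [h0]
  simpa using hε

end Field

/-- As a polynomial in `t`, the constant coefficient of the universal multiplier polynomial has
leading coefficient `±1`, and the other coefficients have smaller degree. -/
theorem universalMultiplierPoly_coeff {d : ℕ} (hd : 2 ≤ d) {m : ℕ} (hm : m ≠ 0) :
    IsUnit ((universalMultiplierPoly hd hm).coeff 0).leadingCoeff ∧
      ∀ j, j ≠ 0 → ((universalMultiplierPoly hd hm).coeff j).degree <
        ((universalMultiplierPoly hd hm).coeff 0).degree := by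
  obtain ⟨G, hG, hunit⟩ := universalMultiplierPoly_expansion (k := FractionRing ℤ[X])
    (K := AlgebraicClosure (FractionRing ℤ[X])) hd hm
  obtain ⟨D, hD⟩ : ∃ D, D = universalMultiplierPoly hd hm := ⟨_, rfl⟩
  rw [← hD] at hG ⊢
  have hn0 : d * (d - 1) ≠ 0 := Nat.mul_ne_zero (by lia) (by lia)
  have hh : ∀ p : ℤ[X], (expand ℤ (d * (d - 1)) p.reverse).coeff 0 = p.leadingCoeff := fun p => by
    rw [← coeff_zero_reverse, coeff_expand (Nat.pos_of_ne_zero hn0)]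
    simp
  have hG0 := hG 0
  have hD0 : D.coeff 0 ≠ 0 := by
    intro h
    rw [h] at hG0
    simp only [reverse_zero, map_zero, zero_mul, natDegree_zero, mul_zero, pow_zero, mul_one] at hG0
    rw [← hG0] at hunit
    simp at hunit
  -- For j = 0 both cofactors have nonzero constant term, so the powers of X match exactly. For j ≠
  -- 0 only one inequality survives, and its bound is strictly smaller.
  have h1 := le_of_mul_X_pow_eq hG0 (by rw [hh]; simpa using hD0)
  have h2 := le_of_mul_X_pow_eq hG0.symm hunit.ne_zero
  have hexp := le_antisymm h1 h2
  refine ⟨?_, fun j hj => ?_⟩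
  · rw [← hh]
    rw [hexp] at hG0
    rwa [mul_right_cancel₀ (pow_ne_zero _ X_ne_zero) hG0]
  · by_cases hDj : D.coeff j = 0
    · rw [hDj, degree_zero, bot_lt_iff_ne_bot]
      simpa using hD0
    have hjn : j ≤ D.natDegree := le_natDegree_of_ne_zero hDj
    refine degree_lt_degree ?_
    have h3 := le_of_mul_X_pow_eq (hG j) (by rw [hh]; simpa using hDj)
    have h4 : m * (d - 1) * (D.natDegree - j) < m * (d - 1) * (D.natDegree - 0) :=
      Nat.mul_lt_mul_of_pos_left (by lia)
        (Nat.mul_pos (Nat.pos_of_ne_zero hm) (by lia))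
    exact lt_of_mul_lt_mul_left ((h3.trans_lt h4).trans_eq hexp.symm) (Nat.zero_le _)

/-! ### Resultants with δ_m, and the main theorem. -/

theorem monic_or_neg_monic_iff {R : Type*} [CommRing R] {p : R[X]} :
    p.Monic ∨ (-p).Monic ↔ p.leadingCoeff = 1 ∨ p.leadingCoeff = -1 := by
  rw [Monic, Monic, leadingCoeff_neg, neg_eq_iff_eq_neg]

theorem monic_or_neg_monic_multiset_prod {R : Type*} [CommRing R] [IsDomain R] {s : Multiset R[X]}
    (h : ∀ p ∈ s, p.Monic ∨ (-p).Monic) : s.prod.Monic ∨ (-s.prod).Monic := by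
  refine Multiset.prod_induction (fun p : R[X] => p.Monic ∨ (-p).Monic) _ ?_ (.inl monic_one) h
  simp only [monic_or_neg_monic_iff, leadingCoeff_mul]
  rintro a b (ha | ha) (hb | hb) <;> simp [ha, hb]

/-- A polynomial in two variables whose constant coefficient has leading coefficient `±1` and
dominates the other coefficients takes values that are monic up to sign. -/
theorem monic_or_neg_monic_eval_map {L : Type*} [Field L] {D : ℤ[X][X]}
    (h0 : IsUnit (D.coeff 0).leadingCoeff)
    (h1 : ∀ j, j ≠ 0 → (D.coeff j).degree < (D.coeff 0).degree) (r : L) :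
    (eval (C r) (D.map (mapRingHom (Int.castRingHom L)))).Monic ∨
      (-eval (C r) (D.map (mapRingHom (Int.castRingHom L)))).Monic := by
  -- ±1 is nonzero in every characteristic, so the constant coefficient keeps its degree in L, while
  -- the other degrees can only drop.
  have hlc : Int.castRingHom L (D.coeff 0).leadingCoeff = 1 ∨
      Int.castRingHom L (D.coeff 0).leadingCoeff = -1 := by
    rcases Int.isUnit_iff.1 h0 with h | h <;> simp [h]
  have hlc0 : Int.castRingHom L (D.coeff 0).leadingCoeff ≠ 0 := by
    rcases hlc with h | h <;> simp [h]
  have hdeg := degree_map_eq_of_leadingCoeff_ne_zero (Int.castRingHom L) hlc0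
  have hlead := leadingCoeff_map_of_leadingCoeff_ne_zero (Int.castRingHom L) hlc0
  rw [monic_or_neg_monic_iff, eval_map, eval₂_eq_sum_range, Finset.sum_range_succ',
    leadingCoeff_add_of_degree_lt, pow_zero, mul_one, coe_mapRingHom, hlead]
  · exact hlc
  · rw [pow_zero, mul_one, coe_mapRingHom, hdeg]
    refine (degree_sum_le _ _).trans_lt ((Finset.sup_lt_iff ?_).2 fun j _ => ?_)
    · rw [bot_lt_iff_ne_bot, Ne, degree_eq_bot]
      rintro h
      simp [h] at h0
    · refine lt_of_le_of_lt ?_ (h1 (j + 1) j.succ_ne_zero)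
      rw [← C_pow]
      refine (degree_mul_le _ _).trans ?_
      refine (add_le_add degree_map_le degree_C_le).trans ?_
      rw [add_zero]

/-- Resultants with the multiplier polynomials of `z ^ d + c`. -/
theorem exists_resultant_multiplierPoly_eq {d : ℕ} (hd : 2 ≤ d) {O : Type*} [CommRing O]
    [IsDomain O] {m : ℕ} (hm : m ≠ 0) {Φ : O[X]} (hΦ : Φ.Monic) :
    ∃ Ψ : O[X],
      resultant (Φ.map (C : O →+* O[X])) (multiplierPoly (unicritical d (X : O[X])) m)
        = aeval ((d : O[X]) ^ d * X ^ (d - 1)) Ψ ∧ (Ψ.Monic ∨ (-Ψ).Monic) := by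
  obtain ⟨D, hD⟩ : ∃ D, D = universalMultiplierPoly hd hm := ⟨_, rfl⟩
  have hDmon : D.Monic := hD ▸ universalMultiplierPoly_monic hd hm
  -- Ψ is the resultant with D over O[t]; substituting t = d^d c^(d-1) fixes the coefficients of Φ
  -- and turns D into δ_m.
  refine ⟨resultant (Φ.map (C : O →+* O[X])) (D.map (mapRingHom (Int.castRingHom O))), ?_, ?_⟩
  · obtain ⟨ρ, hρ⟩ : ∃ ρ : O[X] →+* O[X],
        ρ = (aeval ((d : O[X]) ^ d * X ^ (d - 1)) : O[X] →ₐ[O] O[X]).toRingHom := ⟨_, rfl⟩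
    have h1 : ρ.comp C = C := by
      ext : 1
      simp [hρ]
    have h2 : ρ.comp (mapRingHom (Int.castRingHom O)) =
        eval₂RingHom (Int.castRingHom O[X]) ((d : O[X]) ^ d * X ^ (d - 1)) :=
      ringHom_ext' (Subsingleton.elim _ _) (by simp [hρ])
    rw [multiplierPoly_unicritical hd hm, ← hD, ← h2]
    conv_lhs => rw [← h1]
    rw [← Polynomial.map_map, ← Polynomial.map_map, (hΦ.map C).natDegree_map,
      (hDmon.map _).natDegree_map, resultant_map_map, hρ]
    rfl
  · let L := AlgebraicClosure (FractionRing O)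
    obtain ⟨ι, hι⟩ : ∃ ι : O →+* L, Function.Injective ι :=
      ⟨_, algebraMap_algebraicClosure_fractionRing_injective O⟩
    have hs : (Φ.map ι).Splits := IsAlgClosed.splits _
    have hΦι : (Φ.map ι).Monic := hΦ.map ι
    have h1 : (mapRingHom ι).comp (C : O →+* O[X]) = (C : L →+* L[X]).comp ι := by
      ext : 1
      simp
    have h2 : (mapRingHom ι).comp (mapRingHom (Int.castRingHom O)) =
        mapRingHom (Int.castRingHom L) := by
      rw [mapRingHom_comp]
      congr 1
      exact Subsingleton.elim _ _
    have hmap : (resultant (Φ.map (C : O →+* O[X]))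
        (D.map (mapRingHom (Int.castRingHom O)))).map ι =
        ((Φ.map ι).roots.map fun r =>
          eval (C r) (D.map (mapRingHom (Int.castRingHom L)))).prod := by
      change mapRingHom ι _ = _
      rw [← resultant_map_map, Polynomial.map_map, Polynomial.map_map, h1, h2, ← Polynomial.map_map,
        hDmon.natDegree_map, hΦ.natDegree_map, ← hΦ.natDegree_map ι,
        ← natDegree_map_eq_of_injective (C_injective (R := L)),
        resultant_eq_prod_eval _ _ _ _ (hs.map C), (hΦι.map C).leadingCoeff, one_pow, one_mul,
        hs.roots_map_of_injective C_injective, Multiset.map_map]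
      · rfl
      · rw [hDmon.natDegree_map]
    have key := monic_or_neg_monic_multiset_prod (s := (Φ.map ι).roots.map fun r =>
      eval (C r) (D.map (mapRingHom (Int.castRingHom L)))) (fun p hp => by
        obtain ⟨r, -, rfl⟩ := Multiset.mem_map.1 hp
        obtain ⟨h0, h⟩ := universalMultiplierPoly_coeff hd hm
        rw [← hD] at h0 h
        exact monic_or_neg_monic_eval_map h0 h r)
    rw [← hmap, ← Polynomial.map_neg] at key
    exact key.imp (monic_of_injective hι) (monic_of_injective hι)

theorem mainTheorem9 (d : ℕ) (hd : 2 ≤ d) :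
    -- Resultants with the multiplier polynomials of `z ^ d + c` over `O[c]`; `X : O[X]` is `c`.
    (∀ (O : Type*) [CommRing O] [IsDomain O] (m : ℕ), 0 < m → ∀ Φ : O[X], Φ.Monic →
      ∃ Ψ : O[X],
        resultant (Φ.map (C : O →+* O[X])) (multiplierPoly (unicritical d (X : O[X])) m)
          = aeval ((d : O[X]) ^ d * X ^ (d - 1)) Ψ ∧
        ((d : O) ≠ 0 → Ψ.Monic ∨ (-Ψ).Monic)) ∧
    -- Parameters with a periodic point of integral multiplier.
    (∀ (O : Type*) [CommRing O] [IsDomain O] (γ : O) (m : ℕ)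
        (z₀ : AlgebraicClosure (FractionRing O)),
      IsPeriodicPoint (unicritical d γ) m z₀ →
      IsIntegral ℤ (multiplier (unicritical d γ) m z₀) →
      IsIntegral ℤ ((d : O) ^ d * γ ^ (d - 1))) ∧
    -- Parabolic parameters.
    (∀ (γ : ℂ) (m : ℕ) (z₀ : ℂ), IsParabolicPeriodicPoint (unicritical d γ) m z₀ →
      IsIntegral ℤ ((d : ℂ) ^ d * γ ^ (d - 1)) ∧
      ∀ q : ℚ, γ = (q : ℂ) → ∃ k : ℤ, (d : ℂ) ^ d * γ ^ (d - 1) = (k : ℂ)) := by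
  refine ⟨fun O _ _ m hm Φ hΦ => ?_, fun O _ _ γ m z₀ hz hω => ?_, fun γ m z₀ h => ?_⟩
  · obtain ⟨Ψ, h1, h2⟩ := exists_resultant_multiplierPoly_eq hd (O := O) hm.ne' hΦ
    exact ⟨Ψ, h1, fun _ => h2⟩
  · exact isIntegral_parameter_of_isIntegral_multiplier hd γ m z₀ hz hω
  · exact isIntegral_parameter_of_isParabolic hd γ m z₀ h
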